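/- **Theorem 3.1.** Let $\alpha>0$. There is a constant $C>0$, depending only on $\alpha$, such that the following holds. Let $(a_n)_{n\ge1}$ be positive numbers with $$a_n\le a_{n+1}\le 1\quad(n\ge1),\qquad a_n\to1,\qquad a_1\ge\alpha ,$$ and let $\mu$ be the measure associated with the Jacobi parameters $a_n$ and $b_n\equiv0$, that is, the compactly supported probability measure on $\mathbb R$ whose orthonormal polynomials $p_n$ (of degree $n$, with positive leading coefficient) satisfy $xp_n(x)=a_{n+1}p_{n+1}(x)+a_np_{n-1}(x)$ for $n\ge0$, where $p_{-1}=0$. For each $x\in(-2,2)$ there is a unique integer $N(x)\ge0$ with $$2a_n\le|x|\ \text{ for }1\le n\le N(x),\qquad 2a_n>|x|\ \text{ for }n>N(x);$$ for $1\le n\le N(x)$ define $\gamma_n(x)\ge0$ by $|x|/a_n=2\cosh\gamma_n(x)$, and put $g(x)=\sum_{j=1}^{N(x)}\gamma_j(x)$. Then $\mu$ is purely absolutely continuous and carried by $(-2,2)$: $d\mu(x)=w(x)\,dx$ with $w$ continuous and strictly positive on $(-2,2)$ and zero outside it. Writing $$w(x)=e^{-2Q(x)}\qquad(x\in(-2,2)),$$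 one has, for every $x\in(-2,2)$ with $N(x)\ge1$ and $a_{N(x)+1}<a_{N(x)+2}$, $$|Q(x)-g(x)|\le h(x),\qquad\text{where}\quad e^{h(x)}=C\,N(x)\,\bigl(a_{N(x)+2}-a_{N(x)+1}\bigr)^{-1}.$$ -/

import Mathlib

open Real Set Filter Topology MeasureTheory Polynomial

namespace JacobiWeights

/-- `p 0, p 1, …` are the orthonormal polynomials of the measure `μ`: `p n` has degree `n` and
positive leading coefficient, and the `p n` are orthonormal in `L²(μ)`. -/
structure IsOrthonormalPolynomials (μ : Measure ℝ) (p : ℕ → ℝ[X]) : Prop where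
  natDegree_eq : ∀ n, (p n).natDegree = n
  leadingCoeff_pos : ∀ n, 0 < (p n).leadingCoeff
  integral_mul : ∀ m n, ∫ x, (p m).eval x * (p n).eval x ∂μ = if m = n then 1 else 0

/-- The three-term recurrence
`x p_n = a_{n+1} p_{n+1} + b_{n+1} p_n + a_n p_{n-1}` for `n ≥ 0`, with `p_{-1} = 0`.
The parameters are indexed from `1`; the values `a 0` and `b 0` play no role. -/
def JacobiRecurrence (a b : ℕ → ℝ) (p : ℕ → ℝ[X]) : Prop :=
  X * p 0 = C (a 1) * p 1 + C (b 1) * p 0 ∧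
    ∀ n, X * p (n + 1) =
      C (a (n + 2)) * p (n + 2) + C (b (n + 2)) * p (n + 1) + C (a (n + 1)) * p n

/-- `μ` is a measure associated with the Jacobi parameters `a 1, a 2, … > 0` and `b 1, b 2, …`: a
compactly supported probability measure on `ℝ` (of infinite support, as it has orthonormal
polynomials of every degree) whose orthonormal polynomials obey the recurrence with these
parameters. -/
structure IsSpectralMeasure (a b : ℕ → ℝ) (μ : Measure ℝ) : Prop where
  isProbabilityMeasure : IsProbabilityMeasure μ
  compactSupport : ∃ K : Set ℝ, IsCompact K ∧ μ Kᶜ = 0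
  pos : ∀ n, 1 ≤ n → 0 < a n
  exists_polynomials : ∃ p : ℕ → ℝ[X], IsOrthonormalPolynomials μ p ∧ JacobiRecurrence a b p

/-- The turning point `N(x)`: the number of indices `n ≥ 1` with `2 a_n ≤ |x|`. -/
noncomputable def turningPoint (a : ℕ → ℝ) (x : ℝ) : ℕ :=
  {n : ℕ | 1 ≤ n ∧ 2 * a n ≤ |x|}.ncard

/-- `γ_n(x) ≥ 0` with `2 cosh γ_n(x) = |x| / a_n` (meaningful when `2 a_n ≤ |x|`). -/
noncomputable def gam (a : ℕ → ℝ) (n : ℕ) (x : ℝ) : ℝ :=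
  Real.arcosh (|x| / (2 * a n))

/-- `g(x) = ∑_{j=1}^{N(x)} γ_j(x)`. -/
noncomputable def g (a : ℕ → ℝ) (x : ℝ) : ℝ :=
  ∑ j ∈ Finset.Icc 1 (turningPoint a x), gam a j x

/-- The error bound `h(x)`, given by `e^{h(x)} = c N(x) (a_{N(x)+2} - a_{N(x)+1})⁻¹`
(meaningful when `c > 0`, `N(x) ≥ 1` and `a_{N(x)+1} < a_{N(x)+2}`). -/
noncomputable def h (c : ℝ) (a : ℕ → ℝ) (x : ℝ) : ℝ :=
  Real.log (c * turningPoint a x *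
    (a (turningPoint a x + 2) - a (turningPoint a x + 1))⁻¹)

end JacobiWeights

/-!
Fix `x` and let `u n = p_n(x)`. The quadratic form
`E_n = a_n² (p_n² + p_{n-1}²) - x a_n p_n p_{n-1}` (`energy`) satisfies
`E_{n+1} - E_n = (a_{n+1}² - a_n²) p_n²` (`energy_succ`). As the `a_n` increase, so does `E_n`; and
as `p_n² ≤ E_n / (a_n² - x² / 4)` once `|x| < 2 a_n`, the quotient `E_n / (a_n² - x² / 4)` decreases
from there on (`gap_mul_energy_le`). So `E_n` converges, uniformly on compact subsets of `(-2, 2)`,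
to a continuous positive limit `E` (`limitEnergy`).

The density of `μ` comes out of `E` without complex analysis. The matrix elements
`∫ x^k p_n p_{n+j} dμ` of the Jacobi operator tend to those of the free operator on `ℤ`
(`tendsto_moment`), hence `∫ f E_n dμ` tends to the integral of `f` against the semicircle law, for
polynomials and then for continuous `f` (`tendsto_integral_mul_energy`). Comparison with
`E_n → E` gives `E dμ = √(4 - x²) / (2π) dx` on `(-2, 2)` (`integral_mul_limitEnergy`). There is no
mass elsewhere, because `|p_n(x)| ≥ n + 1` for `|x| ≥ 2` while `∫ p_n² dμ = 1`
(`measure_compl_Ioo_eq_zero`). So the weight is `w = √(4 - x²) / (2π E)`.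

It remains to bound `E` in terms of `P = e^{g(x)} = ∏ e^{γ_j}`. By symmetry let `x > 0`. Up to the
turning point `N`, a comparison with the roots `e^{± γ_n}` of the frozen recurrence gives
`P ≤ p_N ≤ (2N + 1) P` (`IsRoot.prod_le`, `IsRoot.le_prod`), and `E_{N+2}` is bounded above by a
multiple of `N² P²` and below by a multiple of `(a_{N+2} - a_{N+1}) P²` (`IsRoot.energy_bounds`).
The two monotonicity properties carry these bounds over to `E`, at the cost of one more factor
`(a_{N+2} - a_{N+1})⁻¹` in the upper bound.
-/

namespace JacobiWeights

/-! ### Solutions of the recurrence at a fixed energy -/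

/-- `u 0, u 1, …` is the solution of `x u_n = A_n u_{n+1} + A_{n-1} u_{n-1}` with `u_0 = 1` and
`u_{-1} = 0`. The parameters are indexed from `0`, so `A n` stands for the Jacobi parameter
`a_{n+1}`. -/
structure IsSolution (A : ℕ → ℝ) (x : ℝ) (u : ℕ → ℝ) : Prop where
  zero : u 0 = 1
  one : A 0 * u 1 = x
  step : ∀ n, A (n + 1) * u (n + 2) = x * u (n + 1) - A n * u n

/-- The quadratic form `A_n² (u_{n+1}² + u_n²) - x A_n u_{n+1} u_n`, which is conserved by the
recurrence when `A` is constant and is increasing in `n` when `A` is. -/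
def energy (A : ℕ → ℝ) (x : ℝ) (u : ℕ → ℝ) (n : ℕ) : ℝ :=
  A n ^ 2 * (u (n + 1) ^ 2 + u n ^ 2) - x * A n * u (n + 1) * u n

section Energy

variable {A : ℕ → ℝ} {x : ℝ} {u : ℕ → ℝ}

lemma energy_eq_sq_add (n : ℕ) :
    energy A x u n =
      (A n * u (n + 1) - x / 2 * u n) ^ 2 + (A n ^ 2 - x ^ 2 / 4) * u n ^ 2 := by
  unfold energy; ring

lemma energy_eq_sq_add' (n : ℕ) :
    energy A x u n =
      (A n * u n - x / 2 * u (n + 1)) ^ 2 + (A n ^ 2 - x ^ 2 / 4) * u (n + 1) ^ 2 := by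
  unfold energy; ring

lemma energy_succ (hu : IsSolution A x u) (n : ℕ) :
    energy A x u (n + 1) = energy A x u n + (A (n + 1) ^ 2 - A n ^ 2) * u (n + 1) ^ 2 := by
  have h := hu.step n
  have h2 : A (n + 1) ^ 2 * u (n + 2) ^ 2 = (x * u (n + 1) - A n * u n) ^ 2 := by
    rw [← h]; ring
  have h3 : x * A (n + 1) * u (n + 2) * u (n + 1)
      = x * u (n + 1) * (x * u (n + 1) - A n * u n) := by
    rw [← h]; ring
  unfold energy
  linear_combination h2 - h3

lemma sq_mono (hpos : ∀ n, 0 < A n) (hmono : Monotone A) {m n : ℕ} (h : m ≤ n) :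
    A m ^ 2 ≤ A n ^ 2 :=
  pow_le_pow_left₀ (hpos m).le (hmono h) 2

lemma energy_monotone (hpos : ∀ n, 0 < A n) (hmono : Monotone A) (hu : IsSolution A x u) :
    Monotone (energy A x u) := by
  refine monotone_nat_of_le_succ fun n => ?_
  rw [energy_succ hu]
  nlinarith [mul_nonneg (sub_nonneg.2 (sq_mono hpos hmono n.le_succ)) (sq_nonneg (u (n + 1)))]

lemma gap_pos {n : ℕ} (hpos : ∀ n, 0 < A n) (hx : |x| < 2 * A n) : 0 < A n ^ 2 - x ^ 2 / 4 := by
  have : x ^ 2 < (2 * A n) ^ 2 := sq_lt_sq.2 (by rwa [abs_of_pos (mul_pos two_pos (hpos n))])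
  linarith

lemma IsSolution.ne_zero (hpos : ∀ n, 0 < A n) (hu : IsSolution A x u) (n : ℕ) :
    u n ≠ 0 ∨ u (n + 1) ≠ 0 := by
  induction n with
  | zero => left; simp [hu.zero]
  | succ n ih =>
    by_contra! hc
    have h := hu.step n
    rw [hc.1, hc.2] at h
    have h0 : u n = 0 := by
      have := (hpos n).ne'
      have h' : A n * u n = 0 := by linarith
      simpa [this] using h'
    rcases ih with ih | ih
    · exact ih h0
    · exact ih hc.1

lemma energy_pos (hpos : ∀ n, 0 < A n) (hu : IsSolution A x u) {n : ℕ} (hx : |x| < 2 * A n) :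
    0 < energy A x u n := by
  have hg := gap_pos hpos hx
  rcases hu.ne_zero hpos n with h | h
  · rw [energy_eq_sq_add]; positivity
  · rw [energy_eq_sq_add']; positivity

lemma gap_mul_energy_succ_le (hpos : ∀ n, 0 < A n) (hmono : Monotone A) (hu : IsSolution A x u)
    (n : ℕ) :
    (A n ^ 2 - x ^ 2 / 4) * energy A x u (n + 1)
      ≤ (A (n + 1) ^ 2 - x ^ 2 / 4) * energy A x u n := by
  have h1 := sq_mono hpos hmono n.le_succ
  have h2 : (A n ^ 2 - x ^ 2 / 4) * u (n + 1) ^ 2 ≤ energy A x u n := by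
    rw [energy_eq_sq_add']; nlinarith [sq_nonneg (A n * u n - x / 2 * u (n + 1))]
  rw [energy_succ hu]
  nlinarith [mul_le_mul_of_nonneg_left h2 (sub_nonneg.2 h1)]

/-- Beyond the turning point, `energy / (A_n² - x² / 4)` is decreasing: together with the
monotonicity of the energy itself this is what makes the energies converge. -/
lemma gap_mul_energy_le (hpos : ∀ n, 0 < A n) (hmono : Monotone A) (hu : IsSolution A x u)
    {n m : ℕ} (hnm : n ≤ m) (hx : |x| < 2 * A n) :
    (A n ^ 2 - x ^ 2 / 4) * energy A x u m ≤ (A m ^ 2 - x ^ 2 / 4) * energy A x u n := by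
  induction m, hnm using Nat.le_induction with
  | base => exact le_rfl
  | succ m hnm ih =>
    have hgn := gap_pos hpos hx
    have hgm : 0 < A m ^ 2 - x ^ 2 / 4 :=
      gap_pos hpos (hx.trans_le (by linarith [hmono hnm]))
    have hgm' := hgm.trans_le (sub_le_sub_right (sq_mono hpos hmono m.le_succ) _)
    have h := gap_mul_energy_succ_le hpos hmono hu m
    have h1 := mul_le_mul_of_nonneg_left h hgn.le
    have h2 := mul_le_mul_of_nonneg_left ih hgm'.le
    refine le_of_mul_le_mul_left ?_ hgm
    linarith

lemma energy_sub_le (hpos : ∀ n, 0 < A n) (hmono : Monotone A) (hle : ∀ n, A n ≤ 1)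
    (hu : IsSolution A x u)
    {n m : ℕ} (hnm : n ≤ m) (hx : |x| < 2 * A n) :
    (A n ^ 2 - x ^ 2 / 4) * (energy A x u m - energy A x u n)
      ≤ (1 - A n ^ 2) * energy A x u n := by
  have h := gap_mul_energy_le hpos hmono hu hnm hx
  have h1 : A m ^ 2 ≤ 1 := pow_le_one₀ (hpos m).le (hle m)
  nlinarith [mul_le_mul_of_nonneg_right h1 (energy_pos hpos hu hx).le]

/-- Outside `(-2, 2)` the solution grows at least linearly. -/
lemma IsSolution.le_abs (hpos : ∀ n, 0 < A n) (hle : ∀ n, A n ≤ 1) (hu : IsSolution A x u)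
    (hx : 2 ≤ |x|) (n : ℕ) : (n : ℝ) + 1 ≤ |u n| := by
  have key : (n : ℝ) + 1 ≤ |u n| ∧ 1 ≤ A n * |u (n + 1)| - |u n| := by
    induction n with
    | zero =>
      have : |A 0 * u 1| = |x| := by rw [hu.one]
      rw [abs_mul, abs_of_pos (hpos 0)] at this
      simp only [hu.zero, Nat.cast_zero, abs_one]
      constructor <;> linarith
    | succ n ih =>
      obtain ⟨h1, h2⟩ := ih
      have h3 : |A (n + 1) * u (n + 2)| = |x * u (n + 1) - A n * u n| := by rw [hu.step]
      have h4 := abs_sub_abs_le_abs_sub (x * u (n + 1)) (A n * u n)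
      rw [← h3, abs_mul, abs_mul, abs_mul, abs_of_pos (hpos n), abs_of_pos (hpos (n + 1))] at h4
      have h5 : A n * |u (n + 1)| ≤ |u (n + 1)| :=
        mul_le_of_le_one_left (abs_nonneg _) (hle n)
      have h6 : A n * |u n| ≤ |u n| := mul_le_of_le_one_left (abs_nonneg _) (hle n)
      have h7 := mul_le_mul_of_nonneg_right hx (abs_nonneg (u (n + 1)))
      push_cast
      constructor <;> linarith
  exact key.1

lemma IsSolution.neg (hu : IsSolution A x u) : IsSolution A (-x) (fun n => (-1) ^ n * u n) where
  zero := by simp [hu.zero]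
  one := by simp [hu.one]
  step n := by linear_combination (-1) ^ n * hu.step n

lemma energy_neg (n : ℕ) : energy A (-x) (fun n => (-1) ^ n * u n) n = energy A x u n := by
  have h : ((-1 : ℝ) ^ n) ^ 2 = 1 := by rw [← pow_mul, mul_comm, pow_mul]; simp
  unfold energy
  linear_combination (A n ^ 2 * (u (n + 1) ^ 2 + u n ^ 2) - x * A n * u (n + 1) * u n) * h

end Energy

/-! ### Growth up to the turning point -/

section Growth

variable {A : ℕ → ℝ} {x : ℝ} {u lam : ℕ → ℝ} {N : ℕ}

/-- Of two pairs of reals with equal sum, the one with the larger product lies closer together. -/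
lemma min_le_of_mul_le {s₁ b₁ s₂ b₂ : ℝ} (h : s₁ + b₁ = s₂ + b₂) (h₁ : b₁ ≤ s₁)
    (hm : s₁ * b₁ ≤ s₂ * b₂) : b₁ ≤ b₂ := by
  by_contra! hc
  obtain ⟨d, hd, rfl⟩ : ∃ d, 0 < d ∧ b₁ = b₂ + d := ⟨b₁ - b₂, sub_pos.2 hc, by ring⟩
  obtain rfl : s₂ = s₁ + d := by linarith
  nlinarith [mul_nonneg hd.le (sub_nonneg.2 h₁), mul_pos hd hd]

/-- `lam n ≥ 1` is the larger root of `A_n (lam + lam⁻¹) = x`, for every `n < N`. -/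
structure IsRoot (A : ℕ → ℝ) (x : ℝ) (lam : ℕ → ℝ) (N : ℕ) : Prop where
  one_le : ∀ n < N, 1 ≤ lam n
  eq : ∀ n < N, A n * lam n + A n * (lam n)⁻¹ = x

lemma IsRoot.small_le_large (hpos : ∀ n, 0 < A n) (hl : IsRoot A x lam N) {n : ℕ} (hn : n < N) :
    A n * (lam n)⁻¹ ≤ A n * lam n :=
  mul_le_mul_of_nonneg_left ((inv_le_one_of_one_le₀ (hl.one_le n hn)).trans (hl.one_le n hn))
    (hpos n).le

lemma IsRoot.small_mono (hpos : ∀ n, 0 < A n) (hmono : Monotone A) (hl : IsRoot A x lam N) {n : ℕ}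
    (hn : n + 1 < N) : A n * (lam n)⁻¹ ≤ A (n + 1) * (lam (n + 1))⁻¹ := by
  have hn' : n < N := by omega
  have l1 : lam n ≠ 0 := (zero_lt_one.trans_le (hl.one_le n hn')).ne'
  have l2 : lam (n + 1) ≠ 0 := (zero_lt_one.trans_le (hl.one_le _ hn)).ne'
  refine min_le_of_mul_le (s₁ := A n * lam n) (s₂ := A (n + 1) * lam (n + 1)) ?_
    (hl.small_le_large hpos hn') ?_
  · rw [hl.eq n hn', hl.eq _ hn]
  · have e1 : A n * lam n * (A n * (lam n)⁻¹) = A n ^ 2 := by field_simp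
    have e2 : A (n + 1) * lam (n + 1) * (A (n + 1) * (lam (n + 1))⁻¹) = A (n + 1) ^ 2 := by
      field_simp
    rw [e1, e2]
    exact sq_mono hpos hmono n.le_succ

lemma IsRoot.large_anti (hpos : ∀ n, 0 < A n) (hmono : Monotone A) (hl : IsRoot A x lam N) {n : ℕ}
    (hn : n + 1 < N) : A (n + 1) * lam (n + 1) ≤ A n * lam n := by
  linarith [hl.eq n (by omega), hl.eq _ hn, hl.small_mono hpos hmono hn]

lemma IsRoot.mul_le_step (hpos : ∀ n, 0 < A n) (hl : IsRoot A x lam N) (hu : IsSolution A x u)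
    {n : ℕ} (hn : n < N) (h : lam n * u n ≤ u (n + 1)) :
    A n * lam n * u (n + 1) ≤ A (n + 1) * u (n + 2) := by
  have l0 : 0 < lam n := by linarith [hl.one_le n hn]
  have h1 : u n ≤ (lam n)⁻¹ * u (n + 1) := by
    rw [inv_mul_eq_div, le_div_iff₀ l0]; linarith
  have h2 := mul_le_mul_of_nonneg_left h1 (hpos n).le
  have h3 : x * u (n + 1) = A n * lam n * u (n + 1) + A n * (lam n)⁻¹ * u (n + 1) := by
    rw [← hl.eq n hn]; ring
  rw [hu.step]
  linarith

lemma IsRoot.mul_le (hpos : ∀ n, 0 < A n) (hmono : Monotone A) (hl : IsRoot A x lam N)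
    (hu : IsSolution A x u) {n : ℕ} (hn : n < N) : 0 < u n ∧ lam n * u n ≤ u (n + 1) := by
  induction n with
  | zero =>
    have l0 : 0 < lam 0 := by linarith [hl.one_le 0 hn]
    refine ⟨by simp [hu.zero], ?_⟩
    rw [hu.zero, mul_one]
    refine le_of_mul_le_mul_left ?_ (hpos 0)
    rw [hu.one, ← hl.eq 0 hn]
    have := hpos 0
    have : 0 < A 0 * (lam 0)⁻¹ := by positivity
    linarith
  | succ n ih =>
    obtain ⟨h1, h2⟩ := ih (by omega)
    have l0 : 0 < lam n := by linarith [hl.one_le n (by omega)]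
    have h3 : 0 < u (n + 1) := by have := mul_pos l0 h1; linarith
    refine ⟨h3, le_of_mul_le_mul_left ?_ (hpos (n + 1))⟩
    have h4 := hl.mul_le_step hpos hu (by omega) h2
    have h5 := mul_le_mul_of_nonneg_right (hl.large_anti hpos hmono hn) h3.le
    linarith

lemma IsRoot.one_le_prod (hl : IsRoot A x lam N) {n : ℕ} (hn : n ≤ N) :
    1 ≤ ∏ i ∈ Finset.range n, lam i := by
  induction n with
  | zero => simp
  | succ n ih =>
    rw [Finset.prod_range_succ]
    exact one_le_mul_of_one_le_of_one_le (ih (by omega)) (hl.one_le n hn)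

lemma IsRoot.prod_le (hpos : ∀ n, 0 < A n) (hmono : Monotone A) (hl : IsRoot A x lam N)
    (hu : IsSolution A x u) {n : ℕ} (hn : n ≤ N) : ∏ i ∈ Finset.range n, lam i ≤ u n := by
  induction n with
  | zero => simp [hu.zero]
  | succ n ih =>
    rw [Finset.prod_range_succ]
    have h1 := hl.mul_le hpos hmono hu hn
    have l0 : 0 < lam n := by linarith [hl.one_le n hn]
    nlinarith [mul_le_mul_of_nonneg_left (ih (by omega)) l0.le]

/-- Subtracting the decaying root from the recurrence leaves a quantity that grows by at most a
factor `lam n` at each step, because the decaying roots `A n / lam n` increase with `n`. -/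
lemma IsRoot.sub_small_le (hpos : ∀ n, 0 < A n) (hmono : Monotone A) (hl : IsRoot A x lam N)
    (hu : IsSolution A x u) {n : ℕ} (hn : n < N) :
    A n * u (n + 1) - A n * (lam n)⁻¹ * u n ≤ x * ∏ i ∈ Finset.range n, lam i ∧
      A (n + 1) * u (n + 2) - A n * (lam n)⁻¹ * u (n + 1)
        ≤ x * ∏ i ∈ Finset.range (n + 1), lam i := by
  have conv : ∀ n < N, A n * u (n + 1) - A n * (lam n)⁻¹ * u n ≤ x * ∏ i ∈ Finset.range n, lam i →
      A (n + 1) * u (n + 2) - A n * (lam n)⁻¹ * u (n + 1)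
        ≤ x * ∏ i ∈ Finset.range (n + 1), lam i := by
    intro n hn h
    have l0 : 0 < lam n := by linarith [hl.one_le n hn]
    have h1 := mul_le_mul_of_nonneg_left h l0.le
    have e : lam n * (A n * u (n + 1) - A n * (lam n)⁻¹ * u n)
        = A n * lam n * u (n + 1) - A n * u n := by
      field_simp
    rw [Finset.prod_range_succ, hu.step]
    rw [e] at h1
    have h2 := hl.eq n hn
    have h3 : x * u (n + 1) = A n * lam n * u (n + 1) + A n * (lam n)⁻¹ * u (n + 1) := by
      rw [← h2]; ring
    linarith
  have main : A n * u (n + 1) - A n * (lam n)⁻¹ * u n ≤ x * ∏ i ∈ Finset.range n, lam i := by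
    induction n with
    | zero =>
      have l0 : 0 < lam 0 := by linarith [hl.one_le 0 hn]
      have := hpos 0
      have : 0 < A 0 * (lam 0)⁻¹ := by positivity
      simp only [Finset.range_zero, Finset.prod_empty, hu.zero, zero_add, hu.one]
      linarith
    | succ n ih =>
      have h1 := conv n (by omega) (ih (by omega))
      have h2 := mul_le_mul_of_nonneg_right (hl.small_mono hpos hmono hn)
        (hl.mul_le hpos hmono hu hn).1.le
      linarith
  exact ⟨main, conv n hn main⟩

lemma IsRoot.le_prod (hpos : ∀ n, 0 < A n) (hmono : Monotone A) (hl : IsRoot A x lam N)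
    (hu : IsSolution A x u) {n : ℕ} (hn : n ≤ N) :
    u n ≤ (2 * n + 1) * ∏ i ∈ Finset.range n, lam i := by
  induction n with
  | zero => simp [hu.zero]
  | succ n ih =>
    have h1 := (hl.sub_small_le hpos hmono hu hn).1
    have l1 := hl.one_le n hn
    have hu0 := (hl.mul_le hpos hmono hu hn).1
    have hP := hl.one_le_prod (n := n) (by omega)
    have l0 : (lam n)⁻¹ ≤ 1 := inv_le_one_of_one_le₀ l1
    have h2 : u (n + 1) ≤ (lam n)⁻¹ * u n + (lam n + (lam n)⁻¹) * ∏ i ∈ Finset.range n, lam i := by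
      refine le_of_mul_le_mul_left ?_ (hpos n)
      rw [← hl.eq n hn] at h1
      linarith
    have h3 := mul_le_mul_of_nonneg_right l0 hu0.le
    have h4 := mul_le_mul_of_nonneg_right (l0.trans l1) (zero_le_one.trans hP)
    have h5 := mul_le_mul_of_nonneg_right l1 (zero_le_one.trans hP)
    have h6 := ih (by omega)
    have h7 := mul_le_mul_of_nonneg_left h5 (by positivity : (0 : ℝ) ≤ 2 * n + 1)
    rw [Finset.prod_range_succ]
    push_cast
    linarith

/-- At the turning point `N ≥ 1`, the forward increment `A_N u_{N+1} - (x / 2) u_N` is nonnegative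
and bounded by `x ∏ lam i`. -/
lemma IsRoot.increment_bounds (hpos : ∀ n, 0 < A n) (hmono : Monotone A) (hl : IsRoot A x lam N)
    (hu : IsSolution A x u) (hN : 1 ≤ N) :
    0 ≤ A N * u (N + 1) - x / 2 * u N ∧
      A N * u (N + 1) - x / 2 * u N ≤ x * ∏ i ∈ Finset.range N, lam i := by
  obtain ⟨n, rfl⟩ : ∃ n, N = n + 1 := ⟨N - 1, by omega⟩
  have hn : n < n + 1 := n.lt_succ_self
  have hle := hl.mul_le hpos hmono hu hn
  have h1 := hl.mul_le_step hpos hu hn hle.2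
  have h2 := (hl.sub_small_le hpos hmono hu hn).2
  have l0 : 0 < lam n := by linarith [hl.one_le n hn]
  have hu1 : 0 < u (n + 1) := (mul_pos l0 hle.1).trans_le hle.2
  have h3 := hl.small_le_large hpos hn
  have h4 := hl.eq n hn
  have h5 : x / 2 * u (n + 1) ≤ A n * lam n * u (n + 1) :=
    mul_le_mul_of_nonneg_right (by linarith) hu1.le
  have h6 : A n * (lam n)⁻¹ * u (n + 1) ≤ x / 2 * u (n + 1) :=
    mul_le_mul_of_nonneg_right (by linarith) hu1.le
  constructor <;> linarith

/-- Two-sided bounds for the energy one step past the turning point. -/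
lemma IsRoot.energy_bounds {α : ℝ} (hα : 0 < α) (hA : α ≤ A 0) (hle : ∀ n, A n ≤ 1)
    (hmono : Monotone A) (hl : IsRoot A x lam N) (hu : IsSolution A x u) (hN : 1 ≤ N)
    (hx : x < 2 * A N) (hx0 : 2 * A 0 ≤ x) :
    2 * α ^ 3 * (A (N + 1) - A N) * (∏ i ∈ Finset.range N, lam i) ^ 2 ≤ energy A x u (N + 1) ∧
      α ^ 2 * energy A x u (N + 1) ≤ 38 * N ^ 2 * (∏ i ∈ Finset.range N, lam i) ^ 2 := by
  have hge : ∀ n, α ≤ A n := fun n => hA.trans (hmono n.zero_le)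
  have hpos : ∀ n, 0 < A n := fun n => hα.trans_le (hge n)
  have hxα : α ≤ x / 2 := by linarith
  obtain ⟨i1, i2⟩ := hl.increment_bounds hpos hmono hu hN
  have hP := hl.one_le_prod (n := N) le_rfl
  have hPu := hl.prod_le hpos hmono hu (n := N) le_rfl
  have huP := hl.le_prod hpos hmono hu (n := N) le_rfl
  set P := ∏ i ∈ Finset.range N, lam i
  have hN' : (1 : ℝ) ≤ N := by exact_mod_cast hN
  have hα1 : α ≤ 1 := hA.trans (hle 0)
  have hx2 : x ≤ 2 := by linarith [hle N]
  have hxabs : |x| < 2 * A N := by rwa [abs_of_pos (by linarith)]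
  have hE := energy_pos hpos hu hxabs
  have hgap := gap_pos hpos hxabs
  have hu0 : 0 < u N := by linarith
  have hlow : α * P ≤ A N * u (N + 1) := by
    have := mul_le_mul hxα hPu (by linarith) (by linarith)
    linarith
  have hu1 : 0 < u (N + 1) := by
    have : 0 < A N * u (N + 1) := lt_of_lt_of_le (by positivity) hlow
    exact pos_of_mul_pos_right this (hpos N).le
  have hlow' : α * P ≤ u (N + 1) :=
    hlow.trans (mul_le_of_le_one_left hu1.le (hle N))
  have hd : 0 ≤ A (N + 1) - A N := sub_nonneg.2 (hmono N.le_succ)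
  have hsq : 2 * α * (A (N + 1) - A N) ≤ A (N + 1) ^ 2 - A N ^ 2 := by
    nlinarith [hge N, hge (N + 1)]
  rw [energy_succ hu]
  have hsq1 : (α * P) ^ 2 ≤ u (N + 1) ^ 2 := pow_le_pow_left₀ (by positivity) hlow' 2
  constructor
  · have := mul_le_mul hsq hsq1 (by positivity) (le_trans (by positivity) hsq)
    nlinarith
  · have hu_up : α * u (N + 1) ≤ (2 * N + 3) * P := by
      have e1 : α * u (N + 1) ≤ A N * u (N + 1) := mul_le_mul_of_nonneg_right (hge N) hu1.le
      have e2 : x / 2 * u N ≤ 1 * u N := mul_le_mul_of_nonneg_right (by linarith) hu0.le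
      have e3 : x * P ≤ 2 * P := mul_le_mul_of_nonneg_right hx2 (by linarith)
      linarith
    have hu_sq : (α * u (N + 1)) ^ 2 ≤ ((2 * N + 3) * P) ^ 2 :=
      pow_le_pow_left₀ (by positivity) hu_up 2
    have hE_up : energy A x u N ≤ (2 * P) ^ 2 + ((2 * N + 1) * P) ^ 2 := by
      rw [energy_eq_sq_add]
      have e1 : (A N * u (N + 1) - x / 2 * u N) ^ 2 ≤ (2 * P) ^ 2 := by
        refine pow_le_pow_left₀ i1 (i2.trans ?_) 2
        exact mul_le_mul_of_nonneg_right hx2 (by linarith)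
      have e2 : u N ^ 2 ≤ ((2 * N + 1) * P) ^ 2 := pow_le_pow_left₀ hu0.le huP 2
      have e3 : A N ^ 2 - x ^ 2 / 4 ≤ 1 := by
        have := pow_le_one₀ (n := 2) (hpos N).le (hle N)
        nlinarith [sq_nonneg x]
      have e4 := mul_le_mul e3 e2 (sq_nonneg _) zero_le_one
      linarith
    have hA1 : A (N + 1) ^ 2 - A N ^ 2 ≤ 1 := by
      have := pow_le_one₀ (n := 2) (hpos (N + 1)).le (hle (N + 1))
      nlinarith [sq_nonneg (A N)]
    have f1 : α ^ 2 * energy A x u N ≤ energy A x u N :=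
      mul_le_of_le_one_left hE.le (pow_le_one₀ hα.le hα1)
    have f2 : (A (N + 1) ^ 2 - A N ^ 2) * (α * u (N + 1)) ^ 2 ≤ ((2 * N + 3) * P) ^ 2 :=
      (mul_le_of_le_one_left (sq_nonneg _) hA1).trans hu_sq
    have f3 : (4 + (2 * (N : ℝ) + 1) ^ 2 + (2 * N + 3) ^ 2) * P ^ 2 ≤ 38 * N ^ 2 * P ^ 2 :=
      mul_le_mul_of_nonneg_right (by nlinarith) (sq_nonneg _)
    linarith

end Growth

/-! ### The limit of the energies on `(-2, 2)` -/

section Limit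

variable {A : ℕ → ℝ} {u : ℝ → ℕ → ℝ} {x r : ℝ}

/-- The limit, as a supremum, of the increasing sequence of energies of the solution `u x` at `x`
(a junk value where that sequence is unbounded, which can happen only outside `(-2, 2)`). -/
noncomputable def limitEnergy (A : ℕ → ℝ) (u : ℝ → ℕ → ℝ) (x : ℝ) : ℝ :=
  ⨆ n, energy A x (u x) n

lemma exists_lt_two_mul (hlim : Tendsto A atTop (𝓝 1)) (hr : r < 2) : ∃ n, r < 2 * A n := by
  have h := (hlim.const_mul 2).eventually_const_lt (show r < 2 * 1 by linarith)
  exact h.exists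

lemma continuous_energy (hc : ∀ n, Continuous fun x => u x n) (n : ℕ) :
    Continuous fun x => energy A x (u x) n := by
  have h1 := hc n
  have h2 := hc (n + 1)
  unfold energy
  fun_prop

lemma bddAbove_energy (hpos : ∀ n, 0 < A n) (hmono : Monotone A) (hle : ∀ n, A n ≤ 1)
    (hlim : Tendsto A atTop (𝓝 1)) (hu : ∀ x, IsSolution A x (u x)) (hx : |x| < 2) :
    BddAbove (range (energy A x (u x))) := by
  obtain ⟨n, hn⟩ := exists_lt_two_mul hlim hx
  have hg := gap_pos hpos hn
  have hE := energy_pos hpos (hu x) hn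
  refine ⟨energy A x (u x) n / (A n ^ 2 - x ^ 2 / 4) + energy A x (u x) n, ?_⟩
  rintro _ ⟨m, rfl⟩
  rcases le_total n m with h | h
  · have h1 := energy_sub_le hpos hmono hle (hu x) h hn
    have h2 : energy A x (u x) m - energy A x (u x) n
        ≤ energy A x (u x) n / (A n ^ 2 - x ^ 2 / 4) := by
      rw [le_div_iff₀ hg]
      nlinarith [mul_nonneg (sq_nonneg (A n)) hE.le]
    linarith
  · have := energy_monotone hpos hmono (hu x) h
    have : 0 ≤ energy A x (u x) n / (A n ^ 2 - x ^ 2 / 4) := by positivity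
    linarith

lemma tendsto_energy (hpos : ∀ n, 0 < A n) (hmono : Monotone A) (hle : ∀ n, A n ≤ 1)
    (hlim : Tendsto A atTop (𝓝 1)) (hu : ∀ x, IsSolution A x (u x)) (hx : |x| < 2) :
    Tendsto (energy A x (u x)) atTop (𝓝 (limitEnergy A u x)) :=
  tendsto_atTop_ciSup (energy_monotone hpos hmono (hu x))
    (bddAbove_energy hpos hmono hle hlim hu hx)

lemma energy_le_limitEnergy (hpos : ∀ n, 0 < A n) (hmono : Monotone A) (hle : ∀ n, A n ≤ 1)
    (hlim : Tendsto A atTop (𝓝 1)) (hu : ∀ x, IsSolution A x (u x)) (hx : |x| < 2) (n : ℕ) :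
    energy A x (u x) n ≤ limitEnergy A u x :=
  le_ciSup (bddAbove_energy hpos hmono hle hlim hu hx) n

lemma limitEnergy_pos (hpos : ∀ n, 0 < A n) (hmono : Monotone A) (hle : ∀ n, A n ≤ 1)
    (hlim : Tendsto A atTop (𝓝 1)) (hu : ∀ x, IsSolution A x (u x)) (hx : |x| < 2) :
    0 < limitEnergy A u x := by
  obtain ⟨n, hn⟩ := exists_lt_two_mul hlim hx
  exact (energy_pos hpos (hu x) hn).trans_le (energy_le_limitEnergy hpos hmono hle hlim hu hx n)

lemma gap_mul_limitEnergy_le (hpos : ∀ n, 0 < A n) (hmono : Monotone A) (hle : ∀ n, A n ≤ 1)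
    (hlim : Tendsto A atTop (𝓝 1)) (hu : ∀ x, IsSolution A x (u x)) (hx : |x| < 2) {n : ℕ}
    (hn : |x| < 2 * A n) :
    (A n ^ 2 - x ^ 2 / 4) * limitEnergy A u x ≤ (1 - x ^ 2 / 4) * energy A x (u x) n := by
  refine le_of_tendsto ((tendsto_energy hpos hmono hle hlim hu hx).const_mul _) ?_
  filter_upwards [eventually_ge_atTop n] with m hm
  refine (gap_mul_energy_le hpos hmono (hu x) hm hn).trans ?_
  have := pow_le_one₀ (n := 2) (hpos m).le (hle m)
  exact mul_le_mul_of_nonneg_right (by linarith) (energy_pos hpos (hu x) hn).le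

/-- The energies converge uniformly on compact subsets of `(-2, 2)`. -/
lemma tendstoUniformlyOn_energy (hpos : ∀ n, 0 < A n) (hmono : Monotone A) (hle : ∀ n, A n ≤ 1)
    (hlim : Tendsto A atTop (𝓝 1)) (hu : ∀ x, IsSolution A x (u x))
    (hc : ∀ n, Continuous fun x => u x n) (hr : r < 2) :
    TendstoUniformlyOn (fun n x => energy A x (u x) n) (limitEnergy A u) atTop (Icc (-r) r) := by
  rcases lt_or_ge r 0 with hr0 | hr0
  · rw [Icc_eq_empty (by linarith)]
    exact tendstoUniformlyOn_empty
  obtain ⟨n₀, hn₀⟩ := exists_lt_two_mul hlim hr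
  have hη : 0 < A n₀ ^ 2 - r ^ 2 / 4 := gap_pos hpos (by rwa [abs_of_nonneg hr0])
  set η := A n₀ ^ 2 - r ^ 2 / 4 with hηdef
  obtain ⟨M, hM⟩ := isCompact_Icc.exists_bound_of_continuousOn (s := Icc (-r) r)
    (continuous_energy (A := A) hc n₀).continuousOn
  have hsq : ∀ n, A n ^ 2 ≤ 1 := fun n => pow_le_one₀ (hpos n).le (hle n)
  have hgap : ∀ n, n₀ ≤ n → ∀ x ∈ Icc (-r) r, η ≤ A n ^ 2 - x ^ 2 / 4 := by
    intro n hn x hx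
    have h1 := sq_mono hpos hmono hn
    have h2 : x ^ 2 ≤ r ^ 2 := sq_le_sq' hx.1 hx.2
    linarith
  have habs : ∀ n, n₀ ≤ n → ∀ x ∈ Icc (-r) r, |x| < 2 * A n := by
    intro n hn x hx
    have := hmono hn
    have := abs_le.2 hx
    linarith
  have hbound : ∀ n, n₀ ≤ n → ∀ x ∈ Icc (-r) r, energy A x (u x) n ≤ M / η + M := by
    intro n hn x hx
    have h0 := energy_pos hpos (hu x) (habs n₀ le_rfl x hx)
    have hMx : energy A x (u x) n₀ ≤ M := (le_abs_self _).trans (hM x hx)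
    have h1 := energy_sub_le hpos hmono hle (hu x) hn (habs n₀ le_rfl x hx)
    have h2 := mul_le_mul_of_nonneg_right (hgap n₀ le_rfl x hx)
      (sub_nonneg.2 (energy_monotone hpos hmono (hu x) hn))
    have h3 : energy A x (u x) n - energy A x (u x) n₀ ≤ M / η := by
      rw [le_div_iff₀ hη]
      nlinarith [mul_nonneg (sq_nonneg (A n₀)) h0.le]
    linarith
  have hM0 : 0 ≤ M := (norm_nonneg _).trans (hM 0 ⟨by linarith, hr0⟩)
  have hfinal : ∀ n, n₀ ≤ n → ∀ x ∈ Icc (-r) r,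
      limitEnergy A u x - energy A x (u x) n ≤ (1 - A n ^ 2) * ((M / η + M) / η) := by
    intro n hn x hx
    have hx2 : |x| < 2 := (abs_le.2 hx).trans_lt hr
    refine le_of_tendsto ((tendsto_energy hpos hmono hle hlim hu hx2).sub_const _) ?_
    filter_upwards [eventually_ge_atTop n] with m hm
    have h1 := energy_sub_le hpos hmono hle (hu x) hm (habs n hn x hx)
    have h2 := mul_le_mul_of_nonneg_right (hgap n hn x hx)
      (sub_nonneg.2 (energy_monotone hpos hmono (hu x) hm))
    have h3 := mul_le_mul_of_nonneg_left (hbound n hn x hx) (sub_nonneg.2 (hsq n))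
    rw [← mul_div_assoc, le_div_iff₀ hη]
    linarith
  have hzero : Tendsto (fun n => (1 - A n ^ 2) * ((M / η + M) / η)) atTop (𝓝 0) := by
    have := ((hlim.pow 2).const_sub 1).mul_const ((M / η + M) / η)
    simpa using this
  rw [Metric.tendstoUniformlyOn_iff]
  intro ε hε
  filter_upwards [eventually_ge_atTop n₀, hzero.eventually_lt_const hε] with n hn hnε x hx
  have hx2 : |x| < 2 := (abs_le.2 hx).trans_lt hr
  rw [Real.dist_eq, abs_of_nonneg
    (sub_nonneg.2 (energy_le_limitEnergy hpos hmono hle hlim hu hx2 n))]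
  exact (hfinal n hn x hx).trans_lt hnε

lemma continuousOn_limitEnergy (hpos : ∀ n, 0 < A n) (hmono : Monotone A) (hle : ∀ n, A n ≤ 1)
    (hlim : Tendsto A atTop (𝓝 1)) (hu : ∀ x, IsSolution A x (u x))
    (hc : ∀ n, Continuous fun x => u x n) :
    ContinuousOn (limitEnergy A u) (Ioo (-2) 2) := by
  intro x hx
  have hx2 : |x| < 2 := abs_lt.2 hx
  obtain ⟨r, hxr, hr⟩ := exists_between hx2
  have h1 : ContinuousOn (limitEnergy A u) (Icc (-r) r) :=
    (tendstoUniformlyOn_energy hpos hmono hle hlim hu hc hr).continuousOn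
      (Frequently.of_forall fun n => (continuous_energy hc n).continuousOn)
  exact (h1.continuousAt (Icc_mem_nhds (abs_lt.1 hxr).1 (abs_lt.1 hxr).2)).continuousWithinAt

end Limit

/-! ### Matrix elements of the Jacobi operator far from the origin -/

/-- The matrix element `⟨δ_m, J^k δ_{m + j}⟩` of the free Jacobi operator on `ℤ`, written through
its spectral representation. -/
noncomputable def freeMoment (k j : ℕ) : ℝ :=
  π⁻¹ * ∫ θ in (0)..π, (2 * cos θ) ^ k * cos (j * θ)

lemma freeMoment_zero (j : ℕ) : freeMoment 0 j = if j = 0 then 1 else 0 := by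
  unfold freeMoment
  split_ifs with h
  · subst h
    simp [pi_ne_zero]
  · have hj : (j : ℝ) ≠ 0 := by exact_mod_cast h
    simp only [pow_zero, one_mul]
    rw [intervalIntegral.integral_comp_mul_left (fun y => cos y) hj]
    simp [Real.sin_nat_mul_pi]

lemma freeMoment_succ_zero (k : ℕ) :
    freeMoment (k + 1) 0 = freeMoment k 1 + freeMoment k 1 := by
  unfold freeMoment
  rw [← mul_add, ← intervalIntegral.integral_add
    (by apply Continuous.intervalIntegrable; fun_prop)
    (by apply Continuous.intervalIntegrable; fun_prop)]
  congr 2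
  ext θ
  simp only [CharP.cast_eq_zero, zero_mul, cos_zero, Nat.cast_one, one_mul]
  ring

lemma freeMoment_succ_succ (k j : ℕ) :
    freeMoment (k + 1) (j + 1) = freeMoment k (j + 2) + freeMoment k j := by
  unfold freeMoment
  rw [← mul_add, ← intervalIntegral.integral_add
    (by apply Continuous.intervalIntegrable; fun_prop)
    (by apply Continuous.intervalIntegrable; fun_prop)]
  congr 2
  ext θ
  have h1 : ((j + 2 : ℕ) : ℝ) * θ = ((j + 1 : ℕ) : ℝ) * θ + θ := by push_cast; ring
  have h2 : (j : ℝ) * θ = ((j + 1 : ℕ) : ℝ) * θ - θ := by push_cast; ring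
  rw [h1, h2, cos_add, cos_sub]
  ring

section Spectral

variable {A : ℕ → ℝ} {μ : Measure ℝ} [IsProbabilityMeasure μ] {u : ℝ → ℕ → ℝ}

lemma integrable_of_continuous {K : Set ℝ} (hK : IsCompact K) (hμK : μ Kᶜ = 0) {f : ℝ → ℝ}
    (hf : Continuous f) : Integrable f μ := by
  have h1 : μ.restrict K = μ := Measure.restrict_eq_self_of_ae_mem (mem_ae_iff.2 hμK)
  have h2 : IntegrableOn f K μ := hf.continuousOn.integrableOn_compact hK
  rwa [IntegrableOn, h1] at h2

lemma tendsto_moment {K : Set ℝ} (hK : IsCompact K) (hμK : μ Kᶜ = 0)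
    (hlim : Tendsto A atTop (𝓝 1)) (hu : ∀ x, IsSolution A x (u x))
    (hc : ∀ n, Continuous fun x => u x n)
    (ho : ∀ m n, ∫ x, u x m * u x n ∂μ = if m = n then 1 else 0) (k j : ℕ) :
    Tendsto (fun n => ∫ x, x ^ k * (u x n * u x (n + j)) ∂μ) atTop (𝓝 (freeMoment k j)) := by
  have hint : ∀ k m n, Integrable (fun x => x ^ k * (u x m * u x n)) μ := fun k m n =>
    integrable_of_continuous hK hμK (by have := hc m; have := hc n; fun_prop)
  induction k generalizing j with
  | zero =>
    simp only [pow_zero, one_mul, ho, freeMoment_zero, Nat.left_eq_add]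
    exact tendsto_const_nhds
  | succ k ih =>
    cases j with
    | zero =>
      -- shift `n` by one, so that the recurrence at `n` has its generic form
      rw [freeMoment_succ_zero, ← tendsto_add_atTop_iff_nat 1]
      have h : ∀ n, ∫ x, x ^ (k + 1) * (u x (n + 1) * u x (n + 1 + 0)) ∂μ
          = A (n + 1) * ∫ x, x ^ k * (u x (n + 1) * u x (n + 1 + 1)) ∂μ
            + A n * ∫ x, x ^ k * (u x n * u x (n + 1)) ∂μ := by
        intro n
        rw [← integral_const_mul, ← integral_const_mul, ← integral_add
          ((hint _ _ _).const_mul _) ((hint _ _ _).const_mul _)]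
        congr 1 with x
        linear_combination (-x ^ k * u x (n + 1)) * (hu x).step n
      simp only [h]
      have h1 := ((tendsto_add_atTop_iff_nat 1).2 hlim).mul ((tendsto_add_atTop_iff_nat 1).2 (ih 1))
      simpa using h1.add (hlim.mul (ih 1))
    | succ j =>
      rw [freeMoment_succ_succ]
      have h : ∀ n, ∫ x, x ^ (k + 1) * (u x n * u x (n + (j + 1))) ∂μ
          = A (n + j + 1) * ∫ x, x ^ k * (u x n * u x (n + (j + 2))) ∂μ
            + A (n + j) * ∫ x, x ^ k * (u x n * u x (n + j)) ∂μ := by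
        intro n
        rw [← integral_const_mul, ← integral_const_mul, ← integral_add
          ((hint _ _ _).const_mul _) ((hint _ _ _).const_mul _)]
        congr 1 with x
        have := (hu x).step (n + j)
        simp only [← add_assoc]
        linear_combination (-x ^ k * u x n) * this
      simp only [h]
      have h1 := ((tendsto_add_atTop_iff_nat (j + 1)).2 hlim).mul (ih (j + 2))
      have h2 := ((tendsto_add_atTop_iff_nat j).2 hlim).mul (ih j)
      simpa [add_assoc] using h1.add h2

/-- The semicircle functional, in the angular variable `x = 2 cos θ`. -/
noncomputable def semicircle (f : ℝ → ℝ) : ℝ :=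
  2 / π * ∫ θ in (0)..π, f (2 * cos θ) * sin θ ^ 2

lemma semicircle_pow (k : ℕ) :
    semicircle (fun x => x ^ k) = 2 * freeMoment k 0 - freeMoment (k + 1) 1 := by
  unfold semicircle freeMoment
  have h : ∀ θ : ℝ, (2 * cos θ) ^ k * sin θ ^ 2
      = (2 * cos θ) ^ k * cos ((0 : ℕ) * θ) - 2⁻¹ * ((2 * cos θ) ^ (k + 1) * cos ((1 : ℕ) * θ)) := by
    intro θ
    rw [sin_sq]
    simp only [CharP.cast_eq_zero, zero_mul, cos_zero, Nat.cast_one, one_mul]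
    ring
  simp only [h]
  rw [intervalIntegral.integral_sub (by apply Continuous.intervalIntegrable; fun_prop)
    (by apply Continuous.intervalIntegrable; fun_prop), intervalIntegral.integral_const_mul]
  ring

lemma semicircle_eq_integral {f : ℝ → ℝ} (hf : Continuous f) :
    semicircle f = ∫ x in (-2 : ℝ)..2, f x * (√(4 - x ^ 2) / (2 * π)) := by
  have h := intervalIntegral.integral_comp_mul_deriv (a := 0) (b := π) (f := fun θ => 2 * cos θ)
    (f' := fun θ => 2 * -sin θ) (g := fun x => f x * (√(4 - x ^ 2) / (2 * π)))
    (fun θ _ => (hasDerivAt_cos θ).const_mul 2) (by fun_prop) (by fun_prop)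
  have e : (2 : ℝ) * cos π = -2 := by simp
  have e0 : (2 : ℝ) * cos 0 = 2 := by simp
  simp only [e, e0] at h
  rw [intervalIntegral.integral_symm, ← h, semicircle, ← intervalIntegral.integral_const_mul,
    ← intervalIntegral.integral_neg]
  refine intervalIntegral.integral_congr fun θ hθ => ?_
  rw [uIcc_of_le pi_pos.le] at hθ
  have hs := sin_nonneg_of_mem_Icc hθ
  have e2 : √(4 - (2 * cos θ) ^ 2) = 2 * sin θ := by
    rw [show 4 - (2 * cos θ) ^ 2 = (2 * sin θ) ^ 2 by
      have := sin_sq_add_cos_sq θ; linear_combination -4 * this]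
    exact sqrt_sq (by linarith)
  simp only [Function.comp, e2]
  have := pi_ne_zero
  field_simp

lemma semicircle_add {f g : ℝ → ℝ} (hf : Continuous f) (hg : Continuous g) :
    semicircle (fun x => f x + g x) = semicircle f + semicircle g := by
  unfold semicircle
  rw [← mul_add, ← intervalIntegral.integral_add
    (by apply Continuous.intervalIntegrable; fun_prop)
    (by apply Continuous.intervalIntegrable; fun_prop)]
  simp only [add_mul]

lemma semicircle_const_mul (c : ℝ) (f : ℝ → ℝ) :
    semicircle (fun x => c * f x) = c * semicircle f := by
  unfold semicircle
  simp only [mul_assoc, intervalIntegral.integral_const_mul]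
  ring

lemma abs_semicircle_sub_le {f g : ℝ → ℝ} (hf : Continuous f) (hg : Continuous g) {ε : ℝ}
    (h : ∀ x ∈ Icc (-2 : ℝ) 2, |f x - g x| ≤ ε) : |semicircle f - semicircle g| ≤ 2 * ε := by
  have e : semicircle f - semicircle g
      = 2 / π * ∫ θ in (0)..π, (f (2 * cos θ) - g (2 * cos θ)) * sin θ ^ 2 := by
    unfold semicircle
    rw [← mul_sub, ← intervalIntegral.integral_sub
      (by apply Continuous.intervalIntegrable; fun_prop)
      (by apply Continuous.intervalIntegrable; fun_prop)]
    simp only [sub_mul]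
  have hb : ‖∫ θ in (0)..π, (f (2 * cos θ) - g (2 * cos θ)) * sin θ ^ 2‖ ≤ ε * |π - 0| := by
    refine intervalIntegral.norm_integral_le_of_norm_le_const fun θ _ => ?_
    have h1 := h (2 * cos θ) ⟨by linarith [neg_one_le_cos θ], by linarith [cos_le_one θ]⟩
    rw [norm_mul, Real.norm_eq_abs, Real.norm_eq_abs, abs_of_nonneg (sq_nonneg (sin θ))]
    have h2 := sin_sq_le_one θ
    exact (mul_le_of_le_one_right (abs_nonneg _) h2).trans h1
  rw [e, abs_mul, abs_of_pos (div_pos two_pos pi_pos)]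
  rw [Real.norm_eq_abs, sub_zero, abs_of_pos pi_pos] at hb
  calc 2 / π * |∫ θ in (0)..π, (f (2 * cos θ) - g (2 * cos θ)) * sin θ ^ 2|
      ≤ 2 / π * (ε * π) := mul_le_mul_of_nonneg_left hb (div_pos two_pos pi_pos).le
    _ = 2 * ε := by have := pi_ne_zero; field_simp

/-- Far from the origin the Jacobi operator looks like the free one, for which the energy density
is the semicircle law. -/
lemma tendsto_integral_polynomial_mul_energy {K : Set ℝ} (hK : IsCompact K) (hμK : μ Kᶜ = 0)
    (hlim : Tendsto A atTop (𝓝 1)) (hu : ∀ x, IsSolution A x (u x))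
    (hc : ∀ n, Continuous fun x => u x n)
    (ho : ∀ m n, ∫ x, u x m * u x n ∂μ = if m = n then 1 else 0) (q : ℝ[X]) :
    Tendsto (fun n => ∫ x, q.eval x * energy A x (u x) n ∂μ) atTop
      (𝓝 (semicircle fun x => q.eval x)) := by
  have hint : ∀ {f : ℝ → ℝ}, Continuous f → Integrable f μ := integrable_of_continuous hK hμK
  have hce := fun n => continuous_energy (A := A) hc n
  induction q using Polynomial.induction_on' with
  | add p q hp hq =>
    simp only [eval_add, add_mul]
    rw [semicircle_add p.continuous q.continuous]
    refine (hp.add hq).congr fun n => ?_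
    have := hce n
    rw [integral_add (hint (by fun_prop)) (hint (by fun_prop))]
  | monomial k c =>
    simp only [eval_monomial]
    rw [semicircle_const_mul, semicircle_pow]
    have hm := tendsto_moment hK hμK hlim hu hc ho
    have h0 := hm k 0
    have h0' := (tendsto_add_atTop_iff_nat 1).2 h0
    have h1 := hm (k + 1) 1
    have h := (((hlim.pow 2).mul (h0'.add h0)).sub (hlim.mul h1)).const_mul c
    have e : c * (1 ^ 2 * (freeMoment k 0 + freeMoment k 0) - 1 * freeMoment (k + 1) 1)
        = c * (2 * freeMoment k 0 - freeMoment (k + 1) 1) := by ring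
    rw [e] at h
    refine h.congr fun n => ?_
    have c1 := hc n
    have c2 := hc (n + 1)
    simp only [add_zero]
    rw [← integral_add (hint (by fun_prop)) (hint (by fun_prop)), ← integral_const_mul,
      ← integral_const_mul, ← integral_sub (hint (by fun_prop)) (hint (by fun_prop)),
      ← integral_const_mul]
    congr 1 with x
    unfold energy
    ring

lemma tendsto_integral_mul_energy {K : Set ℝ} (hK : IsCompact K) (hμK : μ Kᶜ = 0)
    (hpos : ∀ n, 0 < A n) (hle : ∀ n, A n ≤ 1)
    (hlim : Tendsto A atTop (𝓝 1)) (hu : ∀ x, IsSolution A x (u x))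
    (hc : ∀ n, Continuous fun x => u x n)
    (ho : ∀ m n, ∫ x, u x m * u x n ∂μ = if m = n then 1 else 0) {f : ℝ → ℝ} (hf : Continuous f) :
    Tendsto (fun n => ∫ x, f x * energy A x (u x) n ∂μ) atTop (𝓝 (semicircle f)) := by
  have hint : ∀ {f : ℝ → ℝ}, Continuous f → Integrable f μ := integrable_of_continuous hK hμK
  have hce := fun n => continuous_energy (A := A) hc n
  obtain ⟨R, hR2, hKR⟩ : ∃ R : ℝ, 2 ≤ R ∧ ∀ x ∈ K, |x| ≤ R := by
    obtain ⟨R, hR⟩ := hK.isBounded.exists_norm_le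
    exact ⟨max R 2, le_max_right _ _, fun x hx => (hR x hx).trans (le_max_left _ _)⟩
  have haeK : ∀ᵐ x ∂μ, x ∈ K := mem_ae_iff.2 hμK
  -- the total variations of the measures `energy · μ` stay bounded
  have henergy : ∀ n, ∫ x, |energy A x (u x) n| ∂μ ≤ 2 + R := by
    intro n
    have c0 := hce n
    have c1 := hc n
    have c2 := hc (n + 1)
    have h1 : ∫ x, |energy A x (u x) n| ∂μ
        ≤ ∫ x, (1 + R / 2) * (u x (n + 1) * u x (n + 1) + u x n * u x n) ∂μ := by
      refine integral_mono_ae (hint (by fun_prop)) (hint (by fun_prop)) ?_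
      filter_upwards [haeK] with x hx
      have hx := hKR x hx
      have hA0 := hpos n
      have hA1 := hle n
      have hA2 := pow_le_one₀ (n := 2) hA0.le hA1
      have hS : 0 ≤ u x (n + 1) ^ 2 + u x n ^ 2 := by positivity
      have h2 : |A n ^ 2 * (u x (n + 1) ^ 2 + u x n ^ 2)| ≤ u x (n + 1) ^ 2 + u x n ^ 2 := by
        rw [abs_of_nonneg (by positivity)]
        exact mul_le_of_le_one_left hS hA2
      have h3 : |x * A n * u x (n + 1) * u x n| ≤ R * ((u x (n + 1) ^ 2 + u x n ^ 2) / 2) := by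
        rw [mul_assoc, abs_mul]
        have h4 : |u x (n + 1) * u x n| ≤ (u x (n + 1) ^ 2 + u x n ^ 2) / 2 := by
          rw [abs_le]
          constructor <;> nlinarith [sq_nonneg (u x (n + 1) - u x n), sq_nonneg (u x (n + 1) + u x n)]
        have h5 : |x * A n| ≤ R := by
          rw [abs_mul, abs_of_pos hA0]
          exact (mul_le_of_le_one_right (abs_nonneg x) hA1).trans hx
        exact mul_le_mul h5 h4 (abs_nonneg _) (by linarith)
      have h6 := abs_sub (A n ^ 2 * (u x (n + 1) ^ 2 + u x n ^ 2)) (x * A n * u x (n + 1) * u x n)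
      unfold energy
      linarith
    rw [integral_const_mul, integral_add (hint (by fun_prop)) (hint (by fun_prop)), ho, ho] at h1
    simp only [if_true] at h1
    linarith
  rw [Metric.tendsto_atTop]
  intro ε hε
  set δ := ε / (2 * (4 + R)) with hδ
  have hδ0 : 0 < δ := by positivity
  obtain ⟨q, hq⟩ := exists_polynomial_near_of_continuousOn (-R) R f hf.continuousOn δ hδ0
  have hsemi : |semicircle f - semicircle fun x => q.eval x| ≤ 2 * δ := by
    refine abs_semicircle_sub_le hf q.continuous fun x hx => ?_
    rw [abs_sub_comm]
    exact (hq x ⟨by linarith [hx.1], by linarith [hx.2]⟩).le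
  obtain ⟨n₀, hn₀⟩ := Metric.tendsto_atTop.1
    (tendsto_integral_polynomial_mul_energy hK hμK hlim hu hc ho q) (ε / 2) (by positivity)
  refine ⟨n₀, fun n hn => ?_⟩
  have h1 := hn₀ n hn
  rw [Real.dist_eq] at h1 ⊢
  have c0 := hce n
  have hdiff : |∫ x, f x * energy A x (u x) n ∂μ - ∫ x, q.eval x * energy A x (u x) n ∂μ|
      ≤ δ * (2 + R) := by
    rw [← integral_sub (hint (by fun_prop)) (hint (by fun_prop))]
    refine abs_integral_le_integral_abs.trans ?_
    refine (integral_mono_ae (g := fun x => δ * |energy A x (u x) n|) (hint (by fun_prop))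
      (hint (by fun_prop)) ?_).trans ?_
    · filter_upwards [haeK] with x hx
      have hx := abs_le.1 (hKR x hx)
      rw [← sub_mul, abs_mul, abs_sub_comm]
      exact mul_le_mul_of_nonneg_right (hq x hx).le (abs_nonneg _)
    · rw [integral_const_mul]
      exact mul_le_mul_of_nonneg_left (henergy n) hδ0.le
  have hsum : δ * (2 + R) + 2 * δ = ε / 2 := by
    rw [hδ]; field_simp; ring
  have t1 := abs_sub_le (∫ x, f x * energy A x (u x) n ∂μ)
    (∫ x, q.eval x * energy A x (u x) n ∂μ) (semicircle f)
  have t2 := abs_sub_le (∫ x, q.eval x * energy A x (u x) n ∂μ)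
    (semicircle fun x => q.eval x) (semicircle f)
  rw [abs_sub_comm] at hsemi
  linarith

end Spectral

/-! ### Identification of the measure -/

section Density

variable {A : ℕ → ℝ} {μ : Measure ℝ} [IsProbabilityMeasure μ] {u : ℝ → ℕ → ℝ}

lemma measure_compl_Ioo_eq_zero {K : Set ℝ} (hK : IsCompact K) (hμK : μ Kᶜ = 0)
    (hpos : ∀ n, 0 < A n) (hle : ∀ n, A n ≤ 1) (hu : ∀ x, IsSolution A x (u x))
    (hc : ∀ n, Continuous fun x => u x n)
    (ho : ∀ m n, ∫ x, u x m * u x n ∂μ = if m = n then 1 else 0) :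
    μ (Ioo (-2 : ℝ) 2)ᶜ = 0 := by
  rw [← measureReal_eq_zero_iff]
  by_contra hne
  have hm : 0 < μ.real (Ioo (-2 : ℝ) 2)ᶜ := lt_of_le_of_ne measureReal_nonneg (Ne.symm hne)
  have key : ∀ n : ℕ, ((n : ℝ) + 1) ^ 2 * μ.real (Ioo (-2 : ℝ) 2)ᶜ ≤ 1 := by
    intro n
    have c0 := hc n
    have h1 := mul_meas_ge_le_integral_of_nonneg (μ := μ) (f := fun x => u x n * u x n)
      (ae_of_all _ fun x => mul_self_nonneg _)
      (integrable_of_continuous hK hμK (by fun_prop)) (((n : ℝ) + 1) ^ 2)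
    rw [ho, if_pos rfl] at h1
    refine (mul_le_mul_of_nonneg_left (measureReal_mono ?_) (by positivity)).trans h1
    intro x hx
    have hx2 : 2 ≤ |x| := by
      by_contra! hlt
      exact hx (abs_lt.1 hlt)
    have h2 := pow_le_pow_left₀ (by positivity) ((hu x).le_abs hpos hle hx2 n) 2
    rwa [sq_abs, sq (u x n)] at h2
  obtain ⟨n, hn⟩ := exists_nat_gt (1 / μ.real (Ioo (-2 : ℝ) 2)ᶜ)
  rw [div_lt_iff₀ hm] at hn
  have := key n
  nlinarith [mul_nonneg (sq_nonneg (n : ℝ)) hm.le, mul_nonneg (Nat.cast_nonneg (α := ℝ) n) hm.le]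

lemma continuous_cutoff_mul {f G : ℝ → ℝ} {r : ℝ} (hr : r < 2) (hf : Continuous f)
    (h0 : ∀ x, r < |x| → f x = 0) (hG : ContinuousOn G (Ioo (-2) 2)) :
    Continuous fun x => f x * G x := by
  refine continuous_iff_continuousAt.2 fun x => ?_
  rcases lt_or_ge |x| 2 with hx | hx
  · exact hf.continuousAt.mul (hG.continuousAt (Ioo_mem_nhds (abs_lt.1 hx).1 (abs_lt.1 hx).2))
  · have hev : (fun x => f x * G x) =ᶠ[𝓝 x] fun _ => 0 := by
      filter_upwards [continuous_abs.continuousAt.eventually_const_lt (hr.trans_le hx)] with y hy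
      rw [h0 y hy, zero_mul]
    exact hev.continuousAt

/-- The measure `limitEnergy · μ` is the semicircle law on `(-2, 2)`. -/
lemma integral_mul_limitEnergy {K : Set ℝ} (hK : IsCompact K) (hμK : μ Kᶜ = 0)
    (hpos : ∀ n, 0 < A n) (hmono : Monotone A) (hle : ∀ n, A n ≤ 1)
    (hlim : Tendsto A atTop (𝓝 1)) (hu : ∀ x, IsSolution A x (u x))
    (hc : ∀ n, Continuous fun x => u x n)
    (ho : ∀ m n, ∫ x, u x m * u x n ∂μ = if m = n then 1 else 0) {f : ℝ → ℝ} (hf : Continuous f)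
    {r : ℝ} (hr : r < 2) (h0 : ∀ x, r < |x| → f x = 0) :
    ∫ x, f x * limitEnergy A u x ∂μ = ∫ x in (-2 : ℝ)..2, f x * (√(4 - x ^ 2) / (2 * π)) := by
  rw [← semicircle_eq_integral hf]
  refine tendsto_nhds_unique ?_ (tendsto_integral_mul_energy hK hμK hpos hle hlim hu hc ho hf)
  have hG := continuousOn_limitEnergy hpos hmono hle hlim hu hc
  have hb : Continuous fun x =>
      |f x| * (|energy A x (u x) 0| + |limitEnergy A u x|) :=
    continuous_cutoff_mul hr hf.abs (fun x hx => by rw [h0 x hx, abs_zero])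
      ((continuous_energy hc 0).abs.continuousOn.add hG.abs)
  refine tendsto_integral_of_dominated_convergence _
    (fun n => (hf.mul (continuous_energy hc n)).aestronglyMeasurable)
    (integrable_of_continuous hK hμK hb) ?_ ?_
  · refine fun n => ae_of_all _ fun x => ?_
    rcases lt_or_ge r |x| with hx | hx
    · simp [h0 x hx]
    · rw [norm_mul, Real.norm_eq_abs, Real.norm_eq_abs]
      refine mul_le_mul_of_nonneg_left ?_ (abs_nonneg _)
      have h1 := energy_monotone hpos hmono (hu x) n.zero_le
      have h2 := energy_le_limitEnergy hpos hmono hle hlim hu (hx.trans_lt hr) n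
      rw [abs_le]
      constructor
      · linarith [neg_abs_le (energy A x (u x) 0), abs_nonneg (limitEnergy A u x)]
      · linarith [le_abs_self (limitEnergy A u x), abs_nonneg (energy A x (u x) 0)]
  · refine ae_of_all _ fun x => ?_
    rcases lt_or_ge r |x| with hx | hx
    · simp [h0 x hx]
    · exact (tendsto_energy hpos hmono hle hlim hu (hx.trans_lt hr)).const_mul _

/-- The weight: the semicircle density divided by the limit of the energies. -/
noncomputable def weight (A : ℕ → ℝ) (u : ℝ → ℕ → ℝ) (x : ℝ) : ℝ :=
  √(4 - x ^ 2) / (2 * π * limitEnergy A u x)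

lemma continuousOn_weight (hpos : ∀ n, 0 < A n) (hmono : Monotone A) (hle : ∀ n, A n ≤ 1)
    (hlim : Tendsto A atTop (𝓝 1)) (hu : ∀ x, IsSolution A x (u x))
    (hc : ∀ n, Continuous fun x => u x n) : ContinuousOn (weight A u) (Ioo (-2) 2) := by
  have hG := continuousOn_limitEnergy hpos hmono hle hlim hu hc
  refine ContinuousOn.div (by fun_prop) (continuousOn_const.mul hG) fun x hx => ?_
  have := limitEnergy_pos hpos hmono hle hlim hu (abs_lt.2 hx)
  positivity

lemma sqrt_pos_of_abs_lt {x : ℝ} (hx : |x| < 2) : 0 < √(4 - x ^ 2) := by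
  have : x ^ 2 < 2 ^ 2 := sq_lt_sq.2 (by rwa [abs_two])
  exact sqrt_pos.2 (by linarith)

lemma weight_pos (hpos : ∀ n, 0 < A n) (hmono : Monotone A) (hle : ∀ n, A n ≤ 1)
    (hlim : Tendsto A atTop (𝓝 1)) (hu : ∀ x, IsSolution A x (u x)) {x : ℝ} (hx : |x| < 2) :
    0 < weight A u x := by
  have h1 := limitEnergy_pos hpos hmono hle hlim hu hx
  have h2 := sqrt_pos_of_abs_lt hx
  unfold weight
  positivity

/-- A continuous plateau function on `(-2, 2)`: it vanishes for `|x| ≥ 2 - 1 / (k + 1)` and equals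
`1` for `|x| ≤ 2 - 2 / (k + 1)`. -/
noncomputable def plateau (k : ℕ) (x : ℝ) : ℝ :=
  max 0 (min 1 ((k + 1) * (2 - |x|) - 1))

lemma continuous_plateau (k : ℕ) : Continuous (plateau k) := by
  unfold plateau; fun_prop

lemma plateau_nonneg (k : ℕ) (x : ℝ) : 0 ≤ plateau k x := le_max_left _ _

lemma plateau_eq_zero {k : ℕ} {x : ℝ} (hx : 2 - 1 / ((k : ℝ) + 1) < |x|) : plateau k x = 0 := by
  have hk : (0 : ℝ) < k + 1 := by positivity
  have h : (2 - |x|) * (k + 1) < 1 := by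
    rw [← lt_div_iff₀ hk]; linarith
  exact max_eq_left ((min_le_right _ _).trans (by linarith))

lemma plateau_eq_one {k : ℕ} {x : ℝ} (hx : |x| ≤ 2 - 2 / ((k : ℝ) + 1)) : plateau k x = 1 := by
  have hk : (0 : ℝ) < k + 1 := by positivity
  have h : 2 ≤ (2 - |x|) * (k + 1) := by
    rw [← div_le_iff₀ hk]; linarith
  unfold plateau
  rw [min_eq_left (by linarith), max_eq_right zero_le_one]

lemma withDensity_plateau {K : Set ℝ} (hK : IsCompact K) (hμK : μ Kᶜ = 0)
    (hpos : ∀ n, 0 < A n) (hmono : Monotone A) (hle : ∀ n, A n ≤ 1)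
    (hlim : Tendsto A atTop (𝓝 1)) (hu : ∀ x, IsSolution A x (u x))
    (hc : ∀ n, Continuous fun x => u x n)
    (ho : ∀ m n, ∫ x, u x m * u x n ∂μ = if m = n then 1 else 0) (k : ℕ) :
    μ.withDensity (fun x => ENNReal.ofReal (plateau k x))
      = volume.withDensity (fun x => ENNReal.ofReal (plateau k x * weight A u x)) := by
  have hr : 2 - 1 / ((k : ℝ) + 1) < 2 := by
    have : 0 < 1 / ((k : ℝ) + 1) := by positivity
    linarith
  have hw : ContinuousOn (weight A u) (Ioo (-2) 2) :=
    continuousOn_weight hpos hmono hle hlim hu hc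
  have hχ := continuous_plateau k
  have hχw : Continuous fun x => plateau k x * weight A u x :=
    continuous_cutoff_mul hr hχ (fun x hx => plateau_eq_zero hx) hw
  have hnonneg : ∀ x, 0 ≤ plateau k x * weight A u x := by
    intro x
    rcases lt_or_ge |x| 2 with hx | hx
    · exact mul_nonneg (plateau_nonneg k x) (weight_pos hpos hmono hle hlim hu hx).le
    · rw [plateau_eq_zero (hr.trans_le hx), zero_mul]
  have hcomp : HasCompactSupport fun x => plateau k x * weight A u x := by
    refine HasCompactSupport.intro (isCompact_Icc (a := (-2 : ℝ)) (b := 2)) fun x hx => ?_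
    have hx2 : 2 < |x| := by
      by_contra! h
      exact hx (abs_le.1 h)
    rw [plateau_eq_zero (hr.trans hx2), zero_mul]
  have : IsFiniteMeasure (μ.withDensity fun x => ENNReal.ofReal (plateau k x)) :=
    isFiniteMeasure_withDensity_ofReal (integrable_of_continuous hK hμK hχ).2
  have : IsFiniteMeasure
      (volume.withDensity fun x => ENNReal.ofReal (plateau k x * weight A u x)) :=
    isFiniteMeasure_withDensity_ofReal (hχw.integrable_of_hasCompactSupport hcomp).2
  refine ext_of_forall_integral_eq_of_IsFiniteMeasure fun φ => ?_
  have hφ : Continuous φ := φ.continuous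
  rw [integral_withDensity_eq_integral_toReal_smul hχ.measurable.ennreal_ofReal
      (ae_of_all _ fun x => ENNReal.ofReal_lt_top),
    integral_withDensity_eq_integral_toReal_smul hχw.measurable.ennreal_ofReal
      (ae_of_all _ fun x => ENNReal.ofReal_lt_top)]
  simp only [ENNReal.toReal_ofReal (plateau_nonneg k _), ENNReal.toReal_ofReal (hnonneg _),
    smul_eq_mul]
  -- test the semicircle identity against `φ * plateau / limitEnergy`
  have hGinv : ContinuousOn (fun x => (limitEnergy A u x)⁻¹) (Ioo (-2) 2) :=
    (continuousOn_limitEnergy hpos hmono hle hlim hu hc).inv₀ fun x hx =>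
      (limitEnergy_pos hpos hmono hle hlim hu (abs_lt.2 hx)).ne'
  have hzero : ∀ x, 2 - 1 / ((k : ℝ) + 1) < |x| → plateau k x * φ x = 0 := fun x hx => by
    rw [plateau_eq_zero hx, zero_mul]
  have hF : Continuous fun x => plateau k x * φ x * (limitEnergy A u x)⁻¹ :=
    continuous_cutoff_mul hr (hχ.mul hφ) hzero hGinv
  have main := integral_mul_limitEnergy hK hμK hpos hmono hle hlim hu hc ho hF hr
    (fun x hx => by rw [hzero x hx, zero_mul])
  have e1 : ∀ x, plateau k x * φ x * (limitEnergy A u x)⁻¹ * limitEnergy A u x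
      = plateau k x * φ x := by
    intro x
    rcases lt_or_ge |x| 2 with hx | hx
    · rw [inv_mul_cancel_right₀ (limitEnergy_pos hpos hmono hle hlim hu hx).ne']
    · rw [hzero x (hr.trans_le hx), zero_mul, zero_mul]
  have e2 : ∀ x, plateau k x * φ x * (limitEnergy A u x)⁻¹ * (√(4 - x ^ 2) / (2 * π))
      = plateau k x * weight A u x * φ x := by
    intro x
    unfold weight
    rw [div_eq_mul_inv _ (2 * π * _), mul_inv (2 * π), div_eq_mul_inv]
    ring
  simp only [e1, e2] at main
  rw [main, intervalIntegral.integral_of_le (by norm_num),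
    setIntegral_eq_integral_of_forall_compl_eq_zero]
  intro x hx
  have hx2 : 2 ≤ |x| := by
    by_contra! h
    exact hx (Ioo_subset_Ioc_self (abs_lt.1 h))
  rw [plateau_eq_zero (hr.trans_le hx2), zero_mul, zero_mul]

lemma iUnion_plateau_sets :
    ⋃ k : ℕ, {x : ℝ | |x| ≤ 2 - 2 / ((k : ℝ) + 1)} = Ioo (-2) 2 := by
  ext x
  simp only [mem_iUnion, mem_ofPred_eq]
  constructor
  · rintro ⟨k, hk⟩
    have : 0 < 2 / ((k : ℝ) + 1) := by positivity
    exact abs_lt.1 (by linarith)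
  · intro hx
    have hx2 : 0 < 2 - |x| := sub_pos.2 (abs_lt.2 hx)
    obtain ⟨k, hk⟩ := exists_nat_gt (2 / (2 - |x|))
    refine ⟨k, ?_⟩
    have h1 : 2 / ((k : ℝ) + 1) ≤ 2 - |x| := by
      rw [div_lt_iff₀ hx2] at hk
      rw [div_le_iff₀ (by positivity)]
      linarith
    linarith

lemma eq_withDensity_weight {K : Set ℝ} (hK : IsCompact K) (hμK : μ Kᶜ = 0)
    (hpos : ∀ n, 0 < A n) (hmono : Monotone A) (hle : ∀ n, A n ≤ 1)
    (hlim : Tendsto A atTop (𝓝 1)) (hu : ∀ x, IsSolution A x (u x))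
    (hc : ∀ n, Continuous fun x => u x n)
    (ho : ∀ m n, ∫ x, u x m * u x n ∂μ = if m = n then 1 else 0) :
    μ = (volume.restrict (Ioo (-2 : ℝ) 2)).withDensity
      (fun x => ENNReal.ofReal (weight A u x)) := by
  have h1 : μ.restrict (Ioo (-2) 2) = μ := Measure.restrict_eq_self_of_ae_mem
    (mem_ae_iff.2 (measure_compl_Ioo_eq_zero hK hμK hpos hle hu hc ho))
  rw [← restrict_withDensity measurableSet_Ioo]
  conv_lhs => rw [← h1]
  rw [← iUnion_plateau_sets, Measure.restrict_iUnion_congr]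
  intro k
  ext S hS
  have hT : MeasurableSet {x : ℝ | |x| ≤ 2 - 2 / ((k : ℝ) + 1)} :=
    measurableSet_le (by fun_prop) (by fun_prop)
  rw [Measure.restrict_apply hS, Measure.restrict_apply hS, withDensity_apply _ (hS.inter hT)]
  have h2 := congrArg (fun m : Measure ℝ => m (S ∩ {x : ℝ | |x| ≤ 2 - 2 / ((k : ℝ) + 1)}))
    (withDensity_plateau hK hμK hpos hmono hle hlim hu hc ho k)
  simp only [withDensity_apply _ (hS.inter hT)] at h2
  rw [setLIntegral_congr_fun (f := fun x => ENNReal.ofReal (plateau k x)) (g := fun _ => 1)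
      (hS.inter hT) (fun x hx => by simp [plateau_eq_one hx.2]),
    setLIntegral_congr_fun (f := fun x => ENNReal.ofReal (plateau k x * weight A u x))
      (g := fun x => ENNReal.ofReal (weight A u x)) (hS.inter hT)
      (fun x hx => by simp [plateau_eq_one hx.2])] at h2
  simpa using h2

end Density

/-! ### The turning point and the comparison of exponents -/

lemma turningPoint_spec {a : ℕ → ℝ} (hmono : Monotone fun n => a (n + 1))
    (hlim : Tendsto a atTop (𝓝 1)) {x : ℝ} (hx : |x| < 2) {n : ℕ} (hn : 1 ≤ n) :
    n ≤ turningPoint a x ↔ 2 * a n ≤ |x| := by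
  classical
  have hex : ∃ m, |x| < 2 * a (m + 1) :=
    exists_lt_two_mul (A := fun n => a (n + 1)) ((tendsto_add_atTop_iff_nat 1).2 hlim) hx
  have hiff : ∀ n, 1 ≤ n → (n ≤ Nat.find hex ↔ 2 * a n ≤ |x|) := by
    intro n hn
    obtain ⟨m, rfl⟩ : ∃ m, n = m + 1 := ⟨n - 1, by omega⟩
    constructor
    · intro h
      exact not_lt.1 (Nat.find_min hex h)
    · intro h
      by_contra! hlt
      have h1 : a (Nat.find hex + 1) ≤ a (m + 1) := hmono (Nat.lt_succ_iff.1 hlt)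
      linarith [Nat.find_spec hex]
  have hset : {n : ℕ | 1 ≤ n ∧ 2 * a n ≤ |x|} = ↑(Finset.Icc 1 (Nat.find hex)) := by
    ext n
    simp only [mem_ofPred_eq, Finset.coe_Icc, mem_Icc]
    exact and_congr_right fun h => (hiff n h).symm
  have hN : turningPoint a x = Nat.find hex := by
    rw [turningPoint, hset, Set.ncard_coe_finset, Nat.card_Icc, Nat.add_sub_cancel]
  rw [hN, hiff n hn]

lemma gam_spec {a : ℕ → ℝ} {n : ℕ} {x : ℝ} (hpos : 0 < a n) (hx : 2 * a n ≤ |x|) :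
    0 ≤ gam a n x ∧ |x| / a n = 2 * Real.cosh (gam a n x) := by
  have h1 : 1 ≤ |x| / (2 * a n) := by
    rw [le_div_iff₀ (by positivity)]; linarith
  refine ⟨Real.arcosh_nonneg h1, ?_⟩
  rw [gam, Real.cosh_arcosh h1]
  field_simp

lemma isRoot_exp_gam {a : ℕ → ℝ} (hpos : ∀ n, 0 < a (n + 1)) {x : ℝ} {N : ℕ}
    (hN : ∀ n < N, 2 * a (n + 1) ≤ |x|) :
    IsRoot (fun n => a (n + 1)) |x| (fun n => exp (gam a (n + 1) x)) N where
  one_le n hn := one_le_exp (gam_spec (hpos n) (hN n hn)).1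
  eq n hn := by
    have h := (gam_spec (hpos n) (hN n hn)).2
    have := hpos n
    rw [Real.cosh_eq, div_eq_iff (hpos n).ne'] at h
    rw [← Real.exp_neg]
    linarith

lemma prod_exp_gam (a : ℕ → ℝ) (x : ℝ) :
    ∏ i ∈ Finset.range (turningPoint a x), exp (gam a (i + 1) x) = exp (g a x) := by
  rw [g, ← Real.exp_sum, Finset.range_eq_Ico, Finset.sum_Ico_add' (fun j => gam a j x) 0 _ 1]
  rfl

/-- Two-sided bounds for a weight on the scale `exp (-2 * g)` bound its exponent. -/
lemma abs_exponent_sub_le {w g H : ℝ} (hw : 0 < w) (hH : 0 < H)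
    (h1 : w⁻¹ ≤ exp g ^ 2 * H ^ 2) (h2 : exp g ^ 2 ≤ w⁻¹ * H ^ 2) :
    |-(1 / 2) * log w - g| ≤ log H := by
  have e1 := log_le_log (by positivity) h1
  have e2 := log_le_log (by positivity) h2
  rw [log_inv, log_mul (by positivity) (by positivity), log_pow, log_pow, log_exp] at e1
  rw [log_mul (by positivity) (by positivity), log_inv, log_pow, log_pow, log_exp] at e2
  push_cast at e1 e2
  rw [abs_le]
  constructor <;> linarith

/-- The bounds on the weight `s / (2 π E)` that follow from those on the energies, where
`s = √(4 - x²)`. The square `64 / α⁴` of the constant `8 / α²` has to dominate `19 π / α³` for the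
first inequality. -/
lemma semicircle_div_bounds {α δ s P n E E' : ℝ} (hα : 0 < α) (hα1 : α ≤ 1) (hδ : 0 < δ)
    (hδ1 : δ ≤ 1) (hs : 0 < s) (hs2 : s ≤ 2) (hP : 0 < P) (hn : 1 ≤ n)
    (hlow : 2 * α ^ 3 * δ * P ^ 2 ≤ E') (hEE' : E' ≤ E)
    (hup : α ^ 2 * E' ≤ 38 * n ^ 2 * P ^ 2) (hgap : 2 * α * δ * E ≤ s ^ 2 / 4 * E') :
    (s / (2 * π * E))⁻¹ ≤ P ^ 2 * (8 / α ^ 2 * n * δ⁻¹) ^ 2 ∧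
      P ^ 2 ≤ (s / (2 * π * E))⁻¹ * (8 / α ^ 2 * n * δ⁻¹) ^ 2 := by
  have hE' : 0 < E' := lt_of_lt_of_le (by positivity) hlow
  have hE : 0 < E := hE'.trans_le hEE'
  have hH : (8 / α ^ 2 * n * δ⁻¹) ^ 2 = 64 * n ^ 2 / (α ^ 4 * δ ^ 2) := by
    field_simp; norm_num
  have hαδ : α ^ 4 * δ ^ 2 ≤ α ^ 3 * δ := by
    have : α * δ ≤ 1 := mul_le_one₀ hα1 hδ.le hδ1
    nlinarith [mul_le_mul_of_nonneg_left this (by positivity : 0 ≤ α ^ 3 * δ)]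
  rw [hH, inv_div]
  constructor
  · have h1 : 2 * (α ^ 3 * δ) * E ≤ s ^ 2 / 4 * (38 * n ^ 2 * P ^ 2) := by
      have h := mul_le_mul_of_nonneg_left hgap (sq_nonneg α)
      have h' := mul_le_mul_of_nonneg_left hup (by positivity : 0 ≤ s ^ 2 / 4)
      linarith
    have h2 : s ^ 2 / 4 * (38 * n ^ 2 * P ^ 2) ≤ s * (19 * n ^ 2 * P ^ 2) := by
      have : s ^ 2 / 4 * 38 ≤ s * 19 := by nlinarith
      nlinarith [mul_le_mul_of_nonneg_right this (by positivity : 0 ≤ n ^ 2 * P ^ 2)]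
    have h3 : 2 * π * E * (α ^ 4 * δ ^ 2) ≤ P ^ 2 * (64 * n ^ 2) * s := by
      have h4 := mul_le_mul_of_nonneg_left hαδ (by positivity : 0 ≤ 2 * π * E)
      have h5 := mul_le_mul_of_nonneg_left (h1.trans h2) pi_pos.le
      have h6 := mul_le_mul_of_nonneg_right pi_lt_d2.le
        (by positivity : 0 ≤ s * (19 * n ^ 2 * P ^ 2))
      have h7 : 0 ≤ s * (n ^ 2 * P ^ 2) := by positivity
      linarith
    rw [div_le_iff₀ hs, ← mul_div_assoc, div_mul_eq_mul_div, le_div_iff₀ (by positivity)]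
    exact h3
  · rw [div_mul_div_comm, le_div_iff₀ (by positivity)]
    have h1 : P ^ 2 * (s * (α ^ 4 * δ ^ 2)) ≤ P ^ 2 * (2 * (α ^ 3 * δ)) :=
      mul_le_mul_of_nonneg_left (mul_le_mul hs2 hαδ (by positivity) (by norm_num)) (sq_nonneg P)
    have h2 : E ≤ 2 * π * E * (64 * n ^ 2) := by
      have h3 : 1 ≤ π * n ^ 2 :=
        one_le_mul_of_one_le_of_one_le (by linarith [pi_gt_three]) (one_le_pow₀ hn)
      have h4 := mul_le_mul_of_nonneg_left h3 hE.le
      linarith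
    linarith

lemma abs_log_weight_sub_le {α : ℝ} (hα : 0 < α) {a : ℕ → ℝ} {u : ℝ → ℕ → ℝ} (hA : α ≤ a 1)
    (hmono : Monotone fun n => a (n + 1)) (hle : ∀ n, a (n + 1) ≤ 1)
    (hlim : Tendsto a atTop (𝓝 1)) (hu : ∀ x, IsSolution (fun n => a (n + 1)) x (u x))
    {x : ℝ} (hx : |x| < 2) (hN : 1 ≤ turningPoint a x)
    (hstep : a (turningPoint a x + 1) < a (turningPoint a x + 2)) :
    |-(1 / 2) * log (weight (fun n => a (n + 1)) u x) - g a x| ≤ h (8 / α ^ 2) a x := by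
  have hpos : ∀ n, 0 < a (n + 1) := fun n => hα.trans_le (hA.trans (hmono n.zero_le))
  have hlim' : Tendsto (fun n => a (n + 1)) atTop (𝓝 1) := (tendsto_add_atTop_iff_nat 1).2 hlim
  have hspec := fun n hn => turningPoint_spec hmono hlim hx (n := n) hn
  set N := turningPoint a x with hNdef
  have hlt : |x| < 2 * a (N + 1) := by
    by_contra! hc
    exact absurd ((hspec (N + 1) (by omega)).2 hc) (by omega)
  have hroot := isRoot_exp_gam hpos (N := N) (x := x) fun n hn =>
    (hspec (n + 1) (by omega)).1 (by omega)
  obtain ⟨v, hv, hve⟩ : ∃ v, IsSolution (fun n => a (n + 1)) |x| v ∧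
      energy (fun n => a (n + 1)) |x| v (N + 1) = energy (fun n => a (n + 1)) x (u x) (N + 1) := by
    rcases abs_choice x with h | h <;> rw [h]
    · exact ⟨u x, hu x, rfl⟩
    · exact ⟨_, (hu x).neg, energy_neg _⟩
  have hb := hroot.energy_bounds (A := fun n => a (n + 1)) hα hA hle hmono hv hN hlt
    ((hspec 1 le_rfl).1 hN)
  rw [prod_exp_gam, hve] at hb
  have hδ : 0 < a (N + 2) - a (N + 1) := sub_pos.2 hstep
  have hs := sqrt_pos_of_abs_lt hx
  have hx4 : x ^ 2 < 2 ^ 2 := sq_lt_sq.2 (by rwa [abs_two])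
  have hs_sq : √(4 - x ^ 2) ^ 2 = 4 - x ^ 2 := sq_sqrt (by linarith)
  have hs2 : √(4 - x ^ 2) ≤ 2 := by
    rw [sqrt_le_left two_pos.le]
    linarith [sq_nonneg x]
  have hlt' : |x| < 2 * a (N + 1 + 1) := hlt.trans (by linarith)
  have hE' : 0 < energy (fun n => a (n + 1)) x (u x) (N + 1) := energy_pos hpos (hu x) hlt'
  have hE := limitEnergy_pos hpos hmono hle hlim' hu hx
  have hgap := gap_mul_limitEnergy_le hpos hmono hle hlim' hu hx (n := N + 1) hlt'
  have hgap' : 2 * α * (a (N + 2) - a (N + 1)) ≤ a (N + 1 + 1) ^ 2 - x ^ 2 / 4 := by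
    have h1 : 0 < a (N + 1) ^ 2 - x ^ 2 / 4 := gap_pos (A := fun n => a (n + 1)) hpos hlt
    have h2 : α ≤ a (N + 1) := hA.trans (hmono N.zero_le)
    have h3 : a (N + 1 + 1) ^ 2 - a (N + 1) ^ 2
        = (a (N + 2) + a (N + 1)) * (a (N + 2) - a (N + 1)) := by ring
    have h4 := mul_le_mul_of_nonneg_right (by linarith : 2 * α ≤ a (N + 2) + a (N + 1)) hδ.le
    linarith
  have key := semicircle_div_bounds (n := N) hα (hA.trans (hle 0)) hδ
    (by linarith [hle (N + 1), hpos N]) hs hs2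
    (exp_pos (g a x)) (by exact_mod_cast hN) hb.1
    (energy_le_limitEnergy hpos hmono hle hlim' hu hx _) hb.2 (by
      rw [hs_sq]
      have := mul_le_mul_of_nonneg_right hgap' hE.le
      linarith)
  have hNpos : (0 : ℝ) < N := by exact_mod_cast hN
  exact abs_exponent_sub_le (weight_pos hpos hmono hle hlim' hu hx) (by positivity) key.1 key.2

/-! ### Passage from orthonormal polynomials to solutions -/

lemma IsOrthonormalPolynomials.eval_zero {μ : Measure ℝ} [IsProbabilityMeasure μ] {p : ℕ → ℝ[X]}
    (hp : IsOrthonormalPolynomials μ p) (x : ℝ) : (p 0).eval x = 1 := by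
  have h1 := eq_C_of_natDegree_eq_zero (hp.natDegree_eq 0)
  have h2 := hp.leadingCoeff_pos 0
  have h3 := hp.integral_mul 0 0
  rw [h1] at h2 h3 ⊢
  simp only [leadingCoeff_C, eval_C, integral_const, probReal_univ, one_smul, if_true] at h2 h3 ⊢
  nlinarith

lemma JacobiRecurrence.isSolution {a b : ℕ → ℝ} {p : ℕ → ℝ[X]} (hp : JacobiRecurrence a b p)
    (hb : ∀ n, 1 ≤ n → b n = 0) {x : ℝ} (h0 : (p 0).eval x = 1) :
    IsSolution (fun n => a (n + 1)) x (fun n => (p n).eval x) where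
  zero := h0
  one := by
    have := congrArg (eval x) hp.1
    simp only [eval_mul, eval_add, eval_X, eval_C, h0, hb 1 le_rfl] at this
    linarith
  step n := by
    have := congrArg (eval x) (hp.2 n)
    simp only [eval_mul, eval_add, eval_X, eval_C, hb (n + 2) (by omega)] at this
    linarith

end JacobiWeights

/-- Weights of monotone Jacobi matrices with zero diagonal. The constant `c` depends only on the
lower bound `α` for the first off-diagonal parameter. -/
theorem theorem3p1 (α : ℝ) (hα : 0 < α) :
    ∃ c : ℝ, 0 < c ∧
      ∀ (a b : ℕ → ℝ) (μ : Measure ℝ),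
        JacobiWeights.IsSpectralMeasure a b μ →
        (∀ n, 1 ≤ n → b n = 0) →
        (∀ n, 1 ≤ n → a n ≤ a (n + 1) ∧ a n ≤ 1) →
        Tendsto a atTop (𝓝 1) →
        α ≤ a 1 →
        -- the turning point and the `γ_n` are what they should be
        (∀ x ∈ Ioo (-2 : ℝ) 2, ∀ n : ℕ, 1 ≤ n →
          (n ≤ JacobiWeights.turningPoint a x →
            2 * a n ≤ |x| ∧ 0 ≤ JacobiWeights.gam a n x ∧
              |x| / a n = 2 * Real.cosh (JacobiWeights.gam a n x)) ∧
          (JacobiWeights.turningPoint a x < n → |x| < 2 * a n)) ∧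
        ∃ w Q : ℝ → ℝ,
          ContinuousOn w (Ioo (-2 : ℝ) 2) ∧
          μ = (volume.restrict (Ioo (-2 : ℝ) 2)).withDensity (fun x => ENNReal.ofReal (w x)) ∧
          (∀ x ∈ Ioo (-2 : ℝ) 2, w x = Real.exp (-2 * Q x)) ∧
          ∀ x ∈ Ioo (-2 : ℝ) 2,
            1 ≤ JacobiWeights.turningPoint a x →
            a (JacobiWeights.turningPoint a x + 1) < a (JacobiWeights.turningPoint a x + 2) →
            |Q x - JacobiWeights.g a x| ≤ JacobiWeights.h c a x := by
  refine ⟨8 / α ^ 2, by positivity, ?_⟩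
  intro a b μ hμ hb hmono hlim hA
  obtain ⟨hprob, ⟨K, hK, hμK⟩, hpos, p, hp, hrec⟩ := hμ
  have hmono' : Monotone fun n => a (n + 1) :=
    monotone_nat_of_le_succ fun n => (hmono (n + 1) (by omega)).1
  have hpos' : ∀ n, 0 < a (n + 1) := fun n => hpos (n + 1) (by omega)
  have hle : ∀ n, a (n + 1) ≤ 1 := fun n => (hmono (n + 1) (by omega)).2
  have hlim' : Tendsto (fun n => a (n + 1)) atTop (𝓝 1) := (tendsto_add_atTop_iff_nat 1).2 hlim
  have hu : ∀ x, JacobiWeights.IsSolution (fun n => a (n + 1)) x (fun n => (p n).eval x) :=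
    fun x => hrec.isSolution hb (hp.eval_zero x)
  have hc : ∀ n, Continuous fun x => (p n).eval x := fun n => (p n).continuous
  constructor
  · intro x hx n hn
    have hspec := JacobiWeights.turningPoint_spec hmono' hlim (abs_lt.2 hx) hn
    exact ⟨fun h => ⟨hspec.1 h, JacobiWeights.gam_spec (hpos n hn) (hspec.1 h)⟩,
      fun h => not_le.1 fun hle => absurd (hspec.2 hle) (by omega)⟩
  · refine ⟨JacobiWeights.weight (fun n => a (n + 1)) fun x n => (p n).eval x,
      fun x => -(1 / 2) * log
        (JacobiWeights.weight (fun n => a (n + 1)) (fun x n => (p n).eval x) x),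
      JacobiWeights.continuousOn_weight hpos' hmono' hle hlim' hu hc,
      JacobiWeights.eq_withDensity_weight hK hμK hpos' hmono' hle hlim' hu hc hp.integral_mul,
      fun x hx => ?_, fun x hx hN hstep => ?_⟩
    · have hw := JacobiWeights.weight_pos hpos' hmono' hle hlim' hu (abs_lt.2 hx)
      rw [← mul_assoc, show (-2 : ℝ) * -(1 / 2) = 1 by norm_num, one_mul, exp_log hw]
    · exact JacobiWeights.abs_log_weight_sub_le hα hA hmono' hle hlim hu (abs_lt.2 hx) hN hstep
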